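/- \textbf{Conventions.} A tree is a nonempty finite rooted tree; a forest is a finite (possibly empty) family of trees; a subforest of a forest is a subfamily of its trees. $\mathrm{Nodes}(t)$ is the set of nodes of $t$ and $\mathrm{root}(t)$ its root. \textbf{Families of trees.} A family of trees $\mathfrak X$ consists of a set $\mathrm{Tree}(\mathfrak X)$ and a set $\mathrm{Forest}(\mathfrak X)$ (trees, respectively forests, with additional structure, isomorphic ones being equal), each element of which has an underlying tree, respectively forest, together with the following operations: deletion of the root, $\mathrm{DelRoot}:\mathrm{Tree}(\mathfrak X)\to\mathrm{Forest}(\mathfrak X)$, where the underlying forest of $\mathrm{DelRoot}(t)$ is the forest obtained from the underlying tree of $t$ by deleting its root; restriction, which assigns to $V\in\mathrm{Forest}(\mathfrak X)$ and a subforest $U\subseteq V$ an element $V|U\in\mathrm{Forest}(\mathfrak X)$; and attachment, which assigns to $t\in\mathrm{Tree}(\mathfrak X)$, $U\in\mathrm{Forest}(\mathfrak X)$ and a (linking) function $\mathbf d:U\to\mathrm{Nodes}(t)$ on the set of trees of $U$ an element $t\leftharpoonup_{\mathbf d}U\in\mathrm{Tree}(\mathfrak X)$. Underlying trees and forests are identified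 by fixed isomorphisms whenever they are said below to be the same; in particular $\mathrm{Nodes}(t\leftharpoonup_{\mathbf d}U)$ is the disjoint union of $\mathrm{Nodes}(t)$ and the nodes of the trees of $U$, and the trees of $\mathrm{DelRoot}(t\leftharpoonup_{\mathbf d}U)$ are the trees $\iota(s)$, $s\in\mathrm{DelRoot}(t)$, where $\iota(s)$ is the one whose root is the root of $s$, and the trees arising from those $u\in U$ with $\mathbf d(u)=\mathrm{root}(t)$, which are again written $u$. \textbf{Axioms.} \begin{enumerate} \item Every finite rooted tree is (up to isomorphism) the underlying tree of some element of $\mathrm{Tree}(\mathfrak X)$, and every finite forest the underlying forest of some element of $\mathrm{Forest}(\mathfrak X)$. \item $V|V=V$ for $V\in\mathrm{Forest}(\mathfrak X)$. \item The underlying forest of $V|U$ is $U$. \item $W|U=(W|V)|U$ for $W\in\mathrm{Forest}(\mathfrak X)$ and subforests $U\subseteq V\subseteq W$. \item The underlying tree of $t\leftharpoonup_{\mathbf d}U$ is formed by linking the root of each tree $u$ of $U$ to the node $\mathbf d(u)$ of $t$. \item There is a unique $e\in\mathrm{Tree}(\mathfrak X)$ with exactly one node and a unique $\emptyset\in\mathrm{Forest}(\mathfrak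 X)$ whose underlying forest is empty. For $U\in\mathrm{Forest}(\mathfrak X)$ write $e\leftharpoonup U$ for the attachment along the unique function $U\to\mathrm{Nodes}(e)$. \item $t=e\leftharpoonup\mathrm{DelRoot}(t)$ and $t=t\leftharpoonup\emptyset$ (along the empty function) for $t\in\mathrm{Tree}(\mathfrak X)$, and $U=\mathrm{DelRoot}(e\leftharpoonup U)$ for $U\in\mathrm{Forest}(\mathfrak X)$. \item For $t_1,t_2,t_3\in\mathrm{Tree}(\mathfrak X)$, $\mathbf d:\mathrm{DelRoot}(t_1)\to\mathrm{Nodes}(t_2)$ and $\mathbf e:\mathrm{DelRoot}(t_2\leftharpoonup_{\mathbf d}\mathrm{DelRoot}(t_1))\to\mathrm{Nodes}(t_3)$, put $\mathbf f=\mathbf e\circ\iota:\mathrm{DelRoot}(t_2)\to\mathrm{Nodes}(t_3)$ and define $\mathbf g:\mathrm{DelRoot}(t_1)\to\mathrm{Nodes}(t_3\leftharpoonup_{\mathbf f}\mathrm{DelRoot}(t_2))$ by $\mathbf g(s)=\mathbf d(s)$ if $\mathbf d(s)\ne\mathrm{root}(t_2)$ and $\mathbf g(s)=\mathbf e(s)$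 if $\mathbf d(s)=\mathrm{root}(t_2)$. Then $$t_3\leftharpoonup_{\mathbf e}\mathrm{DelRoot}(t_2\leftharpoonup_{\mathbf d}\mathrm{DelRoot}(t_1))=(t_3\leftharpoonup_{\mathbf f}\mathrm{DelRoot}(t_2))\leftharpoonup_{\mathbf g}\mathrm{DelRoot}(t_1).$$ \item For $t\in\mathrm{Tree}(\mathfrak X)$, $Y\in\mathrm{Forest}(\mathfrak X)$, $\mathbf d:Y\to\mathrm{Nodes}(t)$ and a subforest $U\subseteq\mathrm{DelRoot}(t\leftharpoonup_{\mathbf d}Y)$, let $V=\{v\in\mathrm{DelRoot}(t):\iota(v)\in U\}$, let $W$ be the set of those $w\in Y$ such that either $\mathbf d(w)=\mathrm{root}(t)$ and $w\in U$, or $\mathbf d(w)\in\mathrm{Nodes}(v)$ for some $v\in V$, and let $\mathbf e:W\to\mathrm{Nodes}(e\leftharpoonup\mathrm{DelRoot}(t)|V)$ be given by $\mathbf e(w)=\mathrm{root}(e)$ if $\mathbf d(w)=\mathrm{root}(t)$ and $\mathbf e(w)=\mathbf d(w)$ otherwise. Then $$e\leftharpoonup\bigl(\mathrm{DelRoot}(t\leftharpoonup_{\mathbf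 d}Y)|U\bigr)=\bigl(e\leftharpoonup(\mathrm{DelRoot}(t)|V)\bigr)\leftharpoonup_{\mathbf e}(Y|W).$$ \end{enumerate} \textbf{Theorem.} Let $k$ be a field of characteristic $0$ and let $\mathfrak X$ be a family of trees satisfying Axioms 1--9. Let $k\{\mathfrak X\}$ be the $k$-vector space with basis $\mathrm{Tree}(\mathfrak X)$, graded by giving degree $n$ to the trees with $n+1$ nodes. Then $k\{\mathfrak X\}$ is a cocommutative graded connected Hopf algebra (all structure maps, including the antipode, respect the grading, and the component of degree $0$ is $k\cdot 1$, of dimension $1$) with unit $e$, product $$t_1\cdot t_2=\sum_{\mathbf d:\mathrm{DelRoot}(t_1)\to\mathrm{Nodes}(t_2)}t_2\leftharpoonup_{\mathbf d}\mathrm{DelRoot}(t_1),$$ coproduct $$\Delta(t)=\sum_{U\subseteq X}\bigl(e\leftharpoonup X|U\bigr)\otimes\bigl(e\leftharpoonup X|(X\setminus U)\bigr),\qquad X=\mathrm{DelRoot}(t),$$ and counit $\epsilon(e)=1$, $\epsilon(t)=0$ for $t\ne e$. The tensor product $k\{\mathfrak X\}\otimes k\{\mathfrak X\}$ carries the ordinary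 product $(a\otimes b)(c\otimes d)=ac\otimes bd$, and cocommutativity is with respect to the ordinary flip. -/

import Mathlib

universe u v w

open scoped TensorProduct

noncomputable section

/-! ### Finite rooted forests and finite rooted trees

Mathlib's `RootedTree` is an order-theoretic notion without forests; here a finite forest is a finite
set of nodes with an acyclic "is the parent of" relation in which every node has at most one parent.
The trees of a forest correspond to its roots, the nodes without parent. -/

/-- A finite (possibly empty) forest of finite rooted trees; `IsParent p c` means that the
node `p` is the parent of the node `c`. -/
structure FinForest where
  Node : Type
  finite_node : Finite Node
  IsParent : Node → Node → Prop
  parent_unique : ∀ p q c, IsParent p c → IsParent q c → p = q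
  acyclic : WellFounded IsParent

attribute [instance] FinForest.finite_node

namespace FinForest

/-- A node without parent. -/
def IsRoot (F : FinForest) (a : F.Node) : Prop := ∀ p, ¬ F.IsParent p a

/-- The set of trees of a forest, each tree being named by its root. -/
abbrev Trees (F : FinForest) : Type := {r : F.Node // F.IsRoot r}

/-- The nodes of the tree `r` of the forest `F`: the root of that tree and its descendants. -/
def nodesOf (F : FinForest) (r : F.Trees) : Set F.Node :=
  {a | Relation.ReflTransGen F.IsParent r.1 a}

/-- Isomorphisms of forests: bijections of the nodes that preserve and reflect the relation
"is the parent of". -/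
abbrev Iso (F G : FinForest) : Type := F.IsParent ≃r G.IsParent

/-- The forest on a set of nodes of `F`, with the parent relation of `F`. -/
abbrev induce (F : FinForest) (s : Set F.Node) : FinForest where
  Node := s
  finite_node := inferInstance
  IsParent p c := F.IsParent p.1 c.1
  parent_unique _ _ _ hp hq := Subtype.ext (F.parent_unique _ _ _ hp hq)
  acyclic := InvImage.wf Subtype.val F.acyclic

/-- The set of all nodes of the trees that belong to a set `U` of trees of `F`. -/
def nodesOver (F : FinForest) (U : Set F.Trees) : Set F.Node :=
  {a | ∃ r ∈ U, a ∈ F.nodesOf r}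

/-- The subforest of `F` that consists of the trees in `U`. -/
abbrev subforest (F : FinForest) (U : Set F.Trees) : FinForest :=
  F.induce (F.nodesOver U)

theorem isRoot_of_iso {F G : FinForest} (φ : Iso F G) {a : F.Node} (h : G.IsRoot (φ a)) :
    F.IsRoot a :=
  fun p hp => h (φ p) (φ.map_rel_iff.2 hp)

theorem isRoot_iso {F G : FinForest} (φ : Iso F G) {a : F.Node} (h : F.IsRoot a) :
    G.IsRoot (φ a) := by
  intro p hp
  refine h (φ.symm p) (φ.map_rel_iff.1 ?_)
  simpa using hp

/-- The roots of a subforest are the roots of the trees it consists of. -/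
theorem subforest_root {F : FinForest} {U : Set F.Trees} {a : (F.subforest U).Node}
    (h : (F.subforest U).IsRoot a) : ∃ r ∈ U, r.1 = a.1 := by
  obtain ⟨a, r, hr, hra⟩ := a
  rcases Relation.ReflTransGen.cases_tail hra with h' | ⟨b, hrb, hba⟩
  · exact ⟨r, hr, h'.symm⟩
  · exact absurd hba (h ⟨b, r, hr, hrb⟩)

end FinForest

/-- A finite rooted tree (nonempty): a forest with exactly one root. -/
structure FinTree extends FinForest where
  root : Node
  isRoot_iff : ∀ a, toFinForest.IsRoot a ↔ a = root

namespace FinTree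

/-- Deleting the root; the trees of the resulting forest are named by the children of the
root. -/
abbrev delRoot (T : FinTree) : FinForest := T.toFinForest.induce {a | a ≠ T.root}

theorem not_isParent_root (T : FinTree) (p : T.Node) : ¬ T.IsParent p T.root :=
  (T.isRoot_iff T.root).2 rfl p

theorem ne_root {T : FinTree} {p c : T.Node} (h : T.IsParent p c) : c ≠ T.root := by
  rintro rfl
  exact T.not_isParent_root p h

theorem delRoot_isRoot_iff (T : FinTree) (a : T.delRoot.Node) :
    T.delRoot.IsRoot a ↔ T.IsParent T.root a.1 := by
  constructor
  · intro h
    have h1 : ¬ T.IsRoot a.1 := fun h' => a.2 ((T.isRoot_iff _).1 h')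
    simp only [FinForest.IsRoot, not_forall, not_not] at h1
    obtain ⟨p, hp⟩ := h1
    by_cases hpr : p = T.root
    · exact hpr ▸ hp
    · exact absurd hp (h ⟨p, hpr⟩)
  · intro h p hp
    exact p.2 (T.parent_unique _ _ _ hp h)

/-- The relation "is the parent of" after each tree `u` of the forest `F` has been linked to the
node `d u` of `T`. -/
def GraftRel (T : FinTree) (F : FinForest) (d : F.Trees → T.Node) :
    T.Node ⊕ F.Node → T.Node ⊕ F.Node → Prop
  | .inl p, .inl c => T.IsParent p c
  | .inl p, .inr c => ∃ h : F.IsRoot c, d ⟨c, h⟩ = p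
  | .inr _, .inl _ => False
  | .inr p, .inr c => F.IsParent p c

/-- The tree formed by linking the root of each tree `u` of the forest `F` to the node `d u`
of `T`. -/
abbrev graft (T : FinTree) (F : FinForest) (d : F.Trees → T.Node) : FinTree where
  Node := T.Node ⊕ F.Node
  finite_node := inferInstance
  IsParent := GraftRel T F d
  parent_unique := by
    rintro (p | p) (q | q) (c | c) hp hq <;> simp only [GraftRel] at hp hq
    · rw [T.parent_unique p q c hp hq]
    · obtain ⟨_, rfl⟩ := hp
      obtain ⟨_, rfl⟩ := hq
      rfl
    · exact absurd hq (hp.1 q)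
    · exact absurd hp (hq.1 p)
    · rw [F.parent_unique p q c hp hq]
  acyclic := by
    have hl : ∀ a, Acc (GraftRel T F d) (.inl a) := by
      intro a
      induction a using T.acyclic.induction with
      | _ a ih =>
        refine ⟨_, ?_⟩
        rintro (b | b) hb
        · exact ih b hb
        · exact hb.elim
    refine ⟨?_⟩
    rintro (a | a)
    · exact hl a
    · induction a using F.acyclic.induction with
      | _ a ih =>
        refine ⟨_, ?_⟩
        rintro (b | b) hb
        · exact hl b
        · exact ih b hb
  root := .inl T.root
  isRoot_iff := by
    rintro (a | a)
    · constructor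
      · intro h
        exact congrArg Sum.inl ((T.isRoot_iff a).1 fun p hp => h (.inl p) hp)
      · intro h
        obtain rfl := Sum.inl.inj h
        rintro (p | p) hp
        · exact T.not_isParent_root p hp
        · exact hp
    · constructor
      · intro h
        have hr : F.IsRoot a := fun p hp => h (.inr p) hp
        exact absurd ⟨hr, rfl⟩ (h (.inl (d ⟨a, hr⟩)))
      · intro h
        cases h

end FinTree

/-! ### Families of trees -/

/-- The data of a family of trees. The elements of `Tree` and of `Forest` are the trees and the
forests with additional structure, isomorphic ones being equal; `under` and `underF` give the underlying finite rooted trees and forests.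
The fields `delRootIso`, `restrictIso` and `attachIso` say that deletion of the root, restriction and
attachment are the expected operations on underlying trees and forests, and they fix the identifications
of nodes that come with this. The element `e` is the tree with one node and `empty` is the empty forest,
see `TreeFamily.Axioms`. -/
structure TreeFamily where
  Tree : Type u
  Forest : Type v
  /-- The underlying tree. -/
  under : Tree → FinTree
  /-- The underlying forest. -/
  underF : Forest → FinForest
  /-- The forest obtained when the root is deleted. -/
  delRoot : Tree → Forest
  delRootIso : ∀ t, FinForest.Iso (underF (delRoot t)) (under t).delRoot
  /-- The restriction `V|U` to a subforest, i.e. to a set `U` of trees of `V`. -/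
  restrict : (V : Forest) → Set (underF V).Trees → Forest
  restrictIso : ∀ (V : Forest) (U : Set (underF V).Trees),
    FinForest.Iso (underF (restrict V U)) ((underF V).subforest U)
  /-- The attachment of `U` to `t` along the linking function `d`. -/
  attach : (t : Tree) → (U : Forest) → ((underF U).Trees → (under t).Node) → Tree
  attachIso : ∀ (t : Tree) (U : Forest) (d : (underF U).Trees → (under t).Node),
    FinForest.Iso (under (attach t U d)).toFinForest ((under t).graft (underF U) d).toFinForest
  e : Tree
  empty : Forest

namespace TreeFamily

variable (X : TreeFamily.{u, v})

/-- The set of nodes of a tree of the family. -/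
abbrev Nodes (t : X.Tree) : Type := (X.under t).Node

/-- The root of a tree of the family. -/
abbrev root (t : X.Tree) : X.Nodes t := (X.under t).root

/-- The set of trees of a forest of the family. -/
abbrev TreesOf (V : X.Forest) : Type := (X.underF V).Trees

instance (t : X.Tree) : Fintype (X.Nodes t) := Fintype.ofFinite _

instance (V : X.Forest) : Finite (X.TreesOf V) :=
  inferInstanceAs (Finite {r : (X.underF V).Node // (X.underF V).IsRoot r})

instance (V : X.Forest) : Fintype (X.TreesOf V) := Fintype.ofFinite _

instance (V : X.Forest) (t : X.Tree) : Fintype (X.TreesOf V → X.Nodes t) := Fintype.ofFinite _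

instance (V : X.Forest) : Fintype (Set (X.TreesOf V)) := Fintype.ofFinite _

/-- The tree whose root is linked to the trees of the forest `U`: the attachment of `U` to `e` along the
only function from `U` to the nodes of `e`. -/
abbrev addRoot (U : X.Forest) : X.Tree := X.attach X.e U fun _ => X.root X.e

variable {X}

/-- A node of `t` other than the root, as a node of the forest `delRoot t`. -/
def toDelRoot {t : X.Tree} (a : X.Nodes t) (h : a ≠ X.root t) :
    (X.underF (X.delRoot t)).Node :=
  (X.delRootIso t).symm ⟨a, h⟩

/-- A child of the root of `t`, as a tree of the forest `delRoot t`. -/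
def childTree {t : X.Tree} (c : X.Nodes t) (h : (X.under t).IsParent (X.root t) c) :
    X.TreesOf (X.delRoot t) :=
  ⟨toDelRoot c (FinTree.ne_root h),
    FinForest.isRoot_iso (X.delRootIso t).symm (((X.under t).delRoot_isRoot_iff ⟨c, _⟩).2 h)⟩

/-- The root of a tree of the forest `delRoot t`, as a node of `t`. -/
def treeRoot {t : X.Tree} (s : X.TreesOf (X.delRoot t)) : X.Nodes t :=
  (X.delRootIso t s.1).1

theorem isParent_treeRoot {t : X.Tree} (s : X.TreesOf (X.delRoot t)) :
    (X.under t).IsParent (X.root t) (treeRoot s) :=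
  ((X.under t).delRoot_isRoot_iff _).1 (FinForest.isRoot_iso (X.delRootIso t) s.2)

section Attach

variable {t : X.Tree} {U : X.Forest} (d : X.TreesOf U → X.Nodes t)

/-- A node of `t`, as a node of the tree obtained by attaching `U` to `t` along `d`. -/
def ofBase (a : X.Nodes t) : X.Nodes (X.attach t U d) :=
  (X.attachIso t U d).symm (Sum.inl a : (X.under t).Node ⊕ (X.underF U).Node)

/-- A node of `U`, as a node of the tree obtained by attaching `U` to `t` along `d`. -/
def ofAttached (a : (X.underF U).Node) : X.Nodes (X.attach t U d) :=
  (X.attachIso t U d).symm (Sum.inr a : (X.under t).Node ⊕ (X.underF U).Node)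

theorem root_attach : X.root (X.attach t U d) = ofBase d (X.root t) :=
  (((X.under (X.attach t U d)).isRoot_iff _).1 (FinForest.isRoot_iso (X.attachIso t U d).symm
    ((((X.under t).graft (X.underF U) d).isRoot_iff _).2 rfl))).symm

theorem isParent_ofBase {c : X.Nodes t} (h : (X.under t).IsParent (X.root t) c) :
    (X.under (X.attach t U d)).IsParent (X.root (X.attach t U d)) (ofBase d c) := by
  rw [root_attach]
  exact (X.attachIso t U d).symm.map_rel_iff.2 h

theorem isParent_ofAttached (x : X.TreesOf U) (h : d x = X.root t) :
    (X.under (X.attach t U d)).IsParent (X.root (X.attach t U d)) (ofAttached d x.1) := by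
  rw [root_attach]
  exact (X.attachIso t U d).symm.map_rel_iff.2 ⟨x.2, h⟩

/-- The injection of the trees of `delRoot t` into the trees of the forest obtained by deleting the root
after attaching `U` to `t` along `d`. -/
def iota (s : X.TreesOf (X.delRoot t)) : X.TreesOf (X.delRoot (X.attach t U d)) :=
  childTree (ofBase d (treeRoot s)) (isParent_ofBase d (isParent_treeRoot s))

/-- A tree `x` of `U` that `d` links to the root of `t`, as a tree of the forest obtained by deleting the
root after attaching `U` to `t` along `d`. -/
def rootLinked (x : X.TreesOf U) (h : d x = X.root t) :
    X.TreesOf (X.delRoot (X.attach t U d)) :=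
  childTree (ofAttached d x.1) (isParent_ofAttached d x h)

end Attach

section Assoc

open scoped Classical

variable {t₁ t₂ t₃ : X.Tree} (d : X.TreesOf (X.delRoot t₁) → X.Nodes t₂)
  (e : X.TreesOf (X.delRoot (X.attach t₂ (X.delRoot t₁) d)) → X.Nodes t₃)

/-- The first component `e ∘ ι` of the pair of linking functions made from the pair `(d, e)`. -/
def assocFst : X.TreesOf (X.delRoot t₂) → X.Nodes t₃ := fun s => e (iota d s)

/-- The second component of the pair of linking functions made from the pair `(d, e)`: it maps `s` to
`d s` if `d s` is not the root of `t₂`, and to `e s` if it is. -/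
def assocSnd :
    X.TreesOf (X.delRoot t₁) → X.Nodes (X.attach t₃ (X.delRoot t₂) (assocFst d e)) := fun s =>
  if h : d s = X.root t₂ then ofBase (assocFst d e) (e (rootLinked d s h))
  else ofAttached (assocFst d e) (toDelRoot (d s) h)

end Assoc

section Restrict

variable {V : X.Forest} {U : Set (X.TreesOf V)}

theorem exists_restrict_root (s : X.TreesOf (X.restrict V U)) :
    ∃ r ∈ U, r.1 = (X.restrictIso V U s.1).1 :=
  FinForest.subforest_root (FinForest.isRoot_iso (X.restrictIso V U) s.2)

/-- A tree of the restriction `V|U`, as a tree of `V`. -/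
def ofRestrict (s : X.TreesOf (X.restrict V U)) : X.TreesOf V :=
  ⟨(X.restrictIso V U s.1).1, by
    obtain ⟨r, _, h⟩ := exists_restrict_root s
    exact h ▸ r.2⟩

theorem ofRestrict_mem (s : X.TreesOf (X.restrict V U)) : ofRestrict s ∈ U := by
  obtain ⟨r, hr, h⟩ := exists_restrict_root s
  have : ofRestrict s = r := Subtype.ext h.symm
  exact this ▸ hr

/-- A node of the subforest `U` of `V`, as a node of the restriction `V|U`. -/
def toRestrict (a : (X.underF V).Node) (h : a ∈ (X.underF V).nodesOver U) :
    (X.underF (X.restrict V U)).Node :=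
  (X.restrictIso V U).symm (⟨a, h⟩ : (X.underF V).nodesOver U)

end Restrict

section HopfCondition

open scoped Classical

variable {t : X.Tree} {Y : X.Forest} (d : X.TreesOf Y → X.Nodes t)
  (U : Set (X.TreesOf (X.delRoot (X.attach t Y d))))

/-- The trees `v` of `delRoot t` with `ι v ∈ U`. -/
def basePart : Set (X.TreesOf (X.delRoot t)) := {v | iota d v ∈ U}

/-- The trees `w` of `Y` that belong to `U` after having been linked to the root of `t`, or that have
been linked to a node of a tree in `basePart d U`. -/
def attachedPart : Set (X.TreesOf Y) :=
  {w | (∃ h : d w = X.root t, rootLinked d w h ∈ U) ∨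
    ∃ h : d w ≠ X.root t, ∃ v ∈ basePart d U,
      toDelRoot (d w) h ∈ (X.underF (X.delRoot t)).nodesOf v}

theorem mem_nodesOver_of_mem_attachedPart {w : X.TreesOf Y} (hw : w ∈ attachedPart d U)
    (h : d w ≠ X.root t) :
    toDelRoot (d w) h ∈ (X.underF (X.delRoot t)).nodesOver (basePart d U) := by
  rcases hw with ⟨h', _⟩ | ⟨_, hv⟩
  · exact absurd h' h
  · exact hv

/-- The linking function that `d` induces on `attachedPart d U`: it maps `w` to the new root if `d w` is the
root of `t`, and to `d w` otherwise. -/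
def partLink : X.TreesOf (X.restrict Y (attachedPart d U)) →
    X.Nodes (X.addRoot (X.restrict (X.delRoot t) (basePart d U))) := fun w =>
  if h : d (ofRestrict w) = X.root t then ofBase _ (X.root X.e)
  else ofAttached _ (toRestrict (toDelRoot (d (ofRestrict w)) h)
    (mem_nodesOver_of_mem_attachedPart d U (ofRestrict_mem w) h))

end HopfCondition

/-- The axioms for families of trees. The two that concern the underlying forest of a restriction and
the underlying tree of an attachment are the fields `restrictIso` and `attachIso` of `TreeFamily`. -/
structure Axioms (X : TreeFamily.{u, v}) : Prop where
  /-- Every finite rooted tree underlies some tree of the family. -/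
  exists_tree : ∀ T : FinTree,
    ∃ t : X.Tree, Nonempty (FinForest.Iso (X.under t).toFinForest T.toFinForest)
  /-- Every finite forest underlies some forest of the family. -/
  exists_forest : ∀ F : FinForest, ∃ V : X.Forest, Nonempty (FinForest.Iso (X.underF V) F)
  /-- `V|V = V`. -/
  restrict_univ : ∀ V : X.Forest, X.restrict V Set.univ = V
  /-- `W|U = (W|V)|U` for `U ⊆ V ⊆ W`. -/
  restrict_restrict : ∀ (W : X.Forest) (U V : Set (X.TreesOf W)), U ⊆ V →
    X.restrict W U = X.restrict (X.restrict W V) {s | ofRestrict s ∈ U}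
  /-- `e` is the unique tree of the family with exactly one node. -/
  card_nodes_eq_one_iff : ∀ t : X.Tree, Nat.card (X.Nodes t) = 1 ↔ t = X.e
  /-- `empty` is the unique forest of the family that has no nodes. -/
  isEmpty_iff : ∀ V : X.Forest, IsEmpty (X.underF V).Node ↔ V = X.empty
  /-- A tree is recovered from the forest obtained by deleting its root. -/
  addRoot_delRoot : ∀ t : X.Tree, X.addRoot (X.delRoot t) = t
  /-- Attaching the empty forest along the empty function changes nothing. -/
  attach_empty : ∀ (t : X.Tree) (o : X.TreesOf X.empty → X.Nodes t), X.attach t X.empty o = t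
  /-- A forest is recovered from the tree obtained by adding a root. -/
  delRoot_addRoot : ∀ V : X.Forest, X.delRoot (X.addRoot V) = V
  /-- The two ways to link the children of the root of `t₁` to `t₂`, and those of the root of `t₂` to `t₃`,
  give the same tree of the family. -/
  attach_attach : ∀ (t₁ t₂ t₃ : X.Tree) (d : X.TreesOf (X.delRoot t₁) → X.Nodes t₂)
    (e : X.TreesOf (X.delRoot (X.attach t₂ (X.delRoot t₁) d)) → X.Nodes t₃),
    X.attach t₃ (X.delRoot (X.attach t₂ (X.delRoot t₁) d)) e =
      X.attach (X.attach t₃ (X.delRoot t₂) (assocFst d e)) (X.delRoot t₁) (assocSnd d e)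
  /-- Compatibility of attachment and restriction. -/
  addRoot_restrict : ∀ (t : X.Tree) (Y : X.Forest) (d : X.TreesOf Y → X.Nodes t)
    (U : Set (X.TreesOf (X.delRoot (X.attach t Y d)))),
    X.addRoot (X.restrict (X.delRoot (X.attach t Y d)) U) =
      X.attach (X.addRoot (X.restrict (X.delRoot t) (basePart d U)))
        (X.restrict Y (attachedPart d U)) (partLink d U)

/-- The span of the basis elements of degree `n`, the degree of a tree with `n + 1` nodes being
`n`. -/
def degreePart {k : Type*} {H : Type*} [Semiring k] [AddCommMonoid H] [Module k H]
    (b : Module.Basis X.Tree k H) (n : ℕ) : Submodule k H :=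
  Submodule.span k (b '' {t | Nat.card (X.Nodes t) = n + 1})

end TreeFamily

/-! ### Graded connected Hopf algebras -/

/-- `𝒜` is a grading of the Hopf algebra `H` by submodules: `H` is their direct sum, and all
structure maps of `H` respect degrees. -/
structure IsHopfGrading (k : Type*) {H : Type*} [CommRing k] [Ring H] [HopfAlgebra k H]
    (𝒜 : ℕ → Submodule k H) : Prop where
  isInternal : DirectSum.IsInternal 𝒜
  one_mem : (1 : H) ∈ 𝒜 0
  mul_mem : ∀ (m n : ℕ) (a b : H), a ∈ 𝒜 m → b ∈ 𝒜 n → a * b ∈ 𝒜 (m + n)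
  counit_eq_zero : ∀ (n : ℕ) (a : H), n ≠ 0 → a ∈ 𝒜 n → Coalgebra.counit (R := k) a = 0
  comul_mem : ∀ (n : ℕ) (a : H), a ∈ 𝒜 n → Coalgebra.comul (R := k) a ∈
    ⨆ (p : ℕ × ℕ) (_ : p.1 + p.2 = n),
      LinearMap.range (TensorProduct.map (𝒜 p.1).subtype (𝒜 p.2).subtype)
  antipode_mem : ∀ (n : ℕ) (a : H), a ∈ 𝒜 n → HopfAlgebra.antipode k a ∈ 𝒜 n

/-- A graded Hopf algebra is connected if its component of degree `0` is one-dimensional, spanned by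
the unit. -/
def IsConnectedGrading (k : Type*) {H : Type*} [Field k] [Ring H] [HopfAlgebra k H]
    (𝒜 : ℕ → Submodule k H) : Prop :=
  Module.finrank k (𝒜 0) = 1 ∧ 𝒜 0 = Submodule.span k {1}

end

/-!
The basis of the Hopf algebra is the set of trees, so every identity between structure maps is a bijection
between the index sets of two finite sums, together with an axiom that says that the terms correspond.

* Associativity: the pairs of linking functions `(d, e)` that index `(t₁ t₂) t₃` correspond to the pairs
  `(assocFst d e, assocSnd d e)` that index `t₁ (t₂ t₃)` (`bijective_assoc`), and the terms agree by
  `Axioms.attach_attach`. That this map is a bijection follows because the trees of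
  `delRoot (attach t U d)` are those of `delRoot t` and those of `U` that `d` links to the root
  (`eq_iota_or_rootLinked`).
* Coassociativity: both iterated coproducts are sums over the ordered partitions of the trees of
  `delRoot t` into three parts, by `Axioms.restrict_restrict` (`sum_split_left_eq_sum_split_right`).
* Multiplicativity of the coproduct: a term of `Δ (t₁ t₂)` is given by a linking function `d` and a set
  `U` of trees. It amounts to a pair of subsets `W`, `V` of the trees of `delRoot t₁` and `delRoot t₂`
  and to linking functions for `W` and for its complement (`bijective_glue_joinParts`): the trees in `U`
  determine `V` and `W`, and a tree of `W` is linked to the root or to a node of `V`. The terms agree by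
  `Axioms.addRoot_restrict`.
* Antipode: in the convolution algebra, the powers `(1 - id) ^ n` vanish at trees of degree less than
  `n`, since `1 - id` vanishes at the unit and degrees add up under the coproduct. Hence the geometric
  series `∑ₙ (1 - id) ^ n` is a two-sided inverse of the identity, and it preserves degrees.

The second linking function of a pair takes values in the nodes of a tree that depends on the first one,
and those that belong to subsets `V` and `W` have types that depend on these subsets. Such functions are
compared by `attachNode` and `baseNode`, which map all these nodes to one type.
-/

/-! ### Nodes of subforests -/

namespace FinForest

theorem exists_mem_nodesOf (F : FinForest) (a : F.Node) : ∃ r : F.Trees, a ∈ F.nodesOf r := by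
  induction a using F.acyclic.induction with
  | _ a ih =>
    by_cases h : F.IsRoot a
    · exact ⟨⟨a, h⟩, Relation.ReflTransGen.refl⟩
    · simp only [IsRoot, not_forall, not_not] at h
      obtain ⟨p, hp⟩ := h
      obtain ⟨r, hr⟩ := ih p hp
      exact ⟨r, Relation.ReflTransGen.tail hr hp⟩

theorem eq_of_mem_nodesOf (F : FinForest) {a : F.Node} {r s : F.Trees} (hr : a ∈ F.nodesOf r)
    (hs : a ∈ F.nodesOf s) : r = s := by
  change Relation.ReflTransGen F.IsParent r.1 a at hr
  induction hr with
  | refl =>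
    rcases Relation.ReflTransGen.cases_tail hs with h | ⟨b, _, hb⟩
    · exact Subtype.ext h
    · exact absurd hb (r.2 b)
  | tail _ hbc ih =>
    rcases Relation.ReflTransGen.cases_tail hs with h | ⟨b, hsb, hb⟩
    · exact absurd hbc (h ▸ s.2 _)
    · obtain rfl := F.parent_unique _ _ _ hb hbc
      exact ih hsb

/-- Every node lies in exactly one tree, so complementary sets of trees have complementary nodes. -/
theorem nodesOver_compl (F : FinForest) (U : Set F.Trees) :
    F.nodesOver Uᶜ = (F.nodesOver U)ᶜ := by
  ext a
  constructor
  · rintro ⟨r, hr, har⟩ ⟨s, hs, has⟩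
    exact hr (F.eq_of_mem_nodesOf har has ▸ hs)
  · intro ha
    obtain ⟨r, hr⟩ := F.exists_mem_nodesOf a
    exact ⟨r, fun h => ha ⟨r, h, hr⟩, hr⟩

theorem coe_mem_nodesOver {F : FinForest} {U : Set F.Trees} {r : F.Trees} (hr : r ∈ U) :
    r.1 ∈ F.nodesOver U :=
  ⟨r, hr, Relation.ReflTransGen.refl⟩

theorem nodesOver_eq_empty_iff (F : FinForest) (U : Set F.Trees) :
    F.nodesOver U = ∅ ↔ U = ∅ := by
  constructor
  · intro h
    refine Set.eq_empty_of_forall_notMem fun r hr => ?_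
    have := coe_mem_nodesOver hr
    rw [h] at this
    exact this
  · rintro rfl
    exact Set.eq_empty_of_forall_notMem fun a ⟨r, hr, _⟩ => hr

end FinForest

namespace TreeFamily

variable {X : TreeFamily.{u, v}}

/-! ### Nodes and trees after deletion of the root and after attachment -/

/-- A node of the forest `delRoot t`, as a node of `t`. -/
def delRootNode {t : X.Tree} (a : (X.underF (X.delRoot t)).Node) : X.Nodes t :=
  (X.delRootIso t a).1

theorem delRootNode_ne_root {t : X.Tree} (a : (X.underF (X.delRoot t)).Node) :
    delRootNode a ≠ X.root t :=
  (X.delRootIso t a).2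

theorem delRootNode_injective {t : X.Tree} :
    Function.Injective (delRootNode : (X.underF (X.delRoot t)).Node → X.Nodes t) := fun _ _ h =>
  (X.delRootIso t).injective (Subtype.ext h)

@[simp]
theorem delRootNode_toDelRoot {t : X.Tree} (a : X.Nodes t) (h : a ≠ X.root t) :
    delRootNode (toDelRoot a h) = a :=
  congrArg Subtype.val ((X.delRootIso t).apply_symm_apply ⟨a, h⟩)

@[simp]
theorem toDelRoot_delRootNode {t : X.Tree} (a : (X.underF (X.delRoot t)).Node)
    (h : delRootNode a ≠ X.root t) : toDelRoot (delRootNode a) h = a :=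
  delRootNode_injective (delRootNode_toDelRoot _ _)

@[simp]
theorem treeRoot_childTree {t : X.Tree} (c : X.Nodes t)
    (h : (X.under t).IsParent (X.root t) c) : treeRoot (childTree c h) = c :=
  delRootNode_toDelRoot c (FinTree.ne_root h)

theorem treeRoot_injective {t : X.Tree} :
    Function.Injective (treeRoot : X.TreesOf (X.delRoot t) → X.Nodes t) := fun _ _ h =>
  Subtype.ext (delRootNode_injective h)

section Attach

variable {t : X.Tree} {U : X.Forest} (d : X.TreesOf U → X.Nodes t)

/-- The decomposition of the nodes of `X.attach t U d` into those of `t` and those of `U`. -/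
def attachNode (a : X.Nodes (X.attach t U d)) : X.Nodes t ⊕ (X.underF U).Node :=
  X.attachIso t U d a

theorem attachNode_injective : Function.Injective (attachNode d) :=
  (X.attachIso t U d).injective

@[simp]
theorem attachNode_ofBase (a : X.Nodes t) : attachNode d (ofBase d a) = Sum.inl a :=
  (X.attachIso t U d).apply_symm_apply _

@[simp]
theorem attachNode_ofAttached (a : (X.underF U).Node) :
    attachNode d (ofAttached d a) = Sum.inr a :=
  (X.attachIso t U d).apply_symm_apply _

@[simp]
theorem treeRoot_iota (s : X.TreesOf (X.delRoot t)) :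
    treeRoot (iota d s) = ofBase d (treeRoot s) :=
  treeRoot_childTree _ _

@[simp]
theorem treeRoot_rootLinked (x : X.TreesOf U) (h : d x = X.root t) :
    treeRoot (rootLinked d x h) = ofAttached d x.1 :=
  treeRoot_childTree _ _

theorem iota_injective : Function.Injective (iota d) := fun s s' h => by
  have := congrArg (fun x => attachNode d (treeRoot x)) h
  simp only [treeRoot_iota, attachNode_ofBase] at this
  exact treeRoot_injective (Sum.inl_injective this)

theorem rootLinked_injective {x y : X.TreesOf U} {hx : d x = X.root t} {hy : d y = X.root t}
    (h : rootLinked d x hx = rootLinked d y hy) : x = y := by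
  have := congrArg (fun x => attachNode d (treeRoot x)) h
  simp only [treeRoot_rootLinked, attachNode_ofAttached] at this
  exact Subtype.ext (Sum.inr_injective this)

theorem iota_ne_rootLinked (s : X.TreesOf (X.delRoot t)) (x : X.TreesOf U)
    (h : d x = X.root t) : iota d s ≠ rootLinked d x h := fun h' => by
  have := congrArg (fun x => attachNode d (treeRoot x)) h'
  simp at this

/-- The trees of `delRoot (attach t U d)` are those of `delRoot t` and those of `U` that `d` links to
the root. -/
theorem eq_iota_or_rootLinked (y : X.TreesOf (X.delRoot (X.attach t U d))) :
    (∃ s, y = iota d s) ∨ ∃ x h, y = rootLinked d x h := by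
  have hy : FinTree.GraftRel (X.under t) (X.underF U) d (attachNode d (X.root _))
      (attachNode d (treeRoot y)) := (X.attachIso t U d).map_rel_iff.2 (isParent_treeRoot y)
  rw [root_attach, attachNode_ofBase] at hy
  rcases hc : attachNode d (treeRoot y) with c | c
  · rw [hc] at hy
    have hy' : (X.under t).IsParent (X.root t) c := hy
    refine Or.inl ⟨childTree c hy', treeRoot_injective (attachNode_injective d ?_)⟩
    rw [treeRoot_iota, treeRoot_childTree, attachNode_ofBase, hc]
  · rw [hc] at hy
    obtain ⟨hr, hd⟩ := hy
    refine Or.inr ⟨⟨c, hr⟩, hd, treeRoot_injective (attachNode_injective d ?_)⟩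
    rw [treeRoot_rootLinked, attachNode_ofAttached, hc]

end Attach

/-! ### Pairs of linking functions -/

section Assoc

open scoped Classical

variable {t₁ t₂ t₃ : X.Tree}

theorem attachNode_assocSnd_of_eq (d : X.TreesOf (X.delRoot t₁) → X.Nodes t₂)
    (e : X.TreesOf (X.delRoot (X.attach t₂ (X.delRoot t₁) d)) → X.Nodes t₃)
    (s : X.TreesOf (X.delRoot t₁)) (h : d s = X.root t₂) :
    attachNode _ (assocSnd d e s) = Sum.inl (e (rootLinked d s h)) := by
  rw [assocSnd, dif_pos h, attachNode_ofBase]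

theorem attachNode_assocSnd_of_ne (d : X.TreesOf (X.delRoot t₁) → X.Nodes t₂)
    (e : X.TreesOf (X.delRoot (X.attach t₂ (X.delRoot t₁) d)) → X.Nodes t₃)
    (s : X.TreesOf (X.delRoot t₁)) (h : d s ≠ X.root t₂) :
    attachNode _ (assocSnd d e s) = Sum.inr (toDelRoot (d s) h) := by
  rw [assocSnd, dif_neg h, attachNode_ofAttached]

/-- The first of two linking functions can be read off from the second component made from them. -/
theorem eq_of_attachNode_assocSnd_eq {d d' : X.TreesOf (X.delRoot t₁) → X.Nodes t₂}
    {e : X.TreesOf (X.delRoot (X.attach t₂ (X.delRoot t₁) d)) → X.Nodes t₃}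
    {e' : X.TreesOf (X.delRoot (X.attach t₂ (X.delRoot t₁) d')) → X.Nodes t₃}
    (h : ∀ s, attachNode _ (assocSnd d e s) = attachNode _ (assocSnd d' e' s)) :
    d = d' := by
  funext s
  have hs := h s
  by_cases h1 : d s = X.root t₂ <;> by_cases h2 : d' s = X.root t₂
  · rw [h1, h2]
  · rw [attachNode_assocSnd_of_eq d e s h1, attachNode_assocSnd_of_ne d' e' s h2] at hs
    cases hs
  · rw [attachNode_assocSnd_of_ne d e s h1, attachNode_assocSnd_of_eq d' e' s h2] at hs
    cases hs
  · rw [attachNode_assocSnd_of_ne d e s h1, attachNode_assocSnd_of_ne d' e' s h2] at hs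
    simpa using congrArg delRootNode (Sum.inr_injective hs)

/-- Surjectivity in `bijective_assoc`. The second component is given by its decomposition into nodes,
whose type does not depend on `f`. -/
theorem exists_assoc_eq (f : X.TreesOf (X.delRoot t₂) → X.Nodes t₃)
    (g : X.TreesOf (X.delRoot t₁) → X.Nodes t₃ ⊕ (X.underF (X.delRoot t₂)).Node) :
    ∃ (d : X.TreesOf (X.delRoot t₁) → X.Nodes t₂)
      (e : X.TreesOf (X.delRoot (X.attach t₂ (X.delRoot t₁) d)) → X.Nodes t₃),
      assocFst d e = f ∧ ∀ s, attachNode _ (assocSnd d e s) = g s := by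
  let d : X.TreesOf (X.delRoot t₁) → X.Nodes t₂ := fun s =>
    Sum.elim (fun _ => X.root t₂) delRootNode (g s)
  let e : X.TreesOf (X.delRoot (X.attach t₂ (X.delRoot t₁) d)) → X.Nodes t₃ := fun y =>
    if h : ∃ s, y = iota d s then f h.choose
    else if h : ∃ x hx, y = rootLinked d x hx then
      Sum.elim id (fun _ => X.root t₃) (g h.choose)
    else X.root t₃
  have he₁ : ∀ s, e (iota d s) = f s := fun s => by
    have h : ∃ s', iota d s = iota d s' := ⟨s, rfl⟩
    simp only [e, dif_pos h]
    rw [← iota_injective d h.choose_spec]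
  have he₂ : ∀ x hx, e (rootLinked d x hx) = Sum.elim id (fun _ => X.root t₃) (g x) := by
    intro x hx
    have h₁ : ¬ ∃ s, rootLinked d x hx = iota d s := fun ⟨s, hs⟩ =>
      iota_ne_rootLinked d s x hx hs.symm
    have h : ∃ y hy, rootLinked d x hx = rootLinked d y hy := ⟨x, hx, rfl⟩
    simp only [e, dif_neg h₁, dif_pos h]
    rw [← rootLinked_injective d h.choose_spec.choose_spec]
  refine ⟨d, e, funext he₁, fun s => ?_⟩
  rcases hs : g s with a | a
  · have h : d s = X.root t₂ := by simp [d, hs]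
    rw [attachNode_assocSnd_of_eq d e s h, he₂, hs]
    rfl
  · have h' : d s = delRootNode a := by simp [d, hs]
    have h : d s ≠ X.root t₂ := h' ▸ delRootNode_ne_root a
    rw [attachNode_assocSnd_of_ne d e s h]
    refine congrArg Sum.inr (delRootNode_injective ?_)
    rw [delRootNode_toDelRoot, h']

/-- The passage from `(d, e)` to `(assocFst d e, assocSnd d e)` is a bijection between the index
sets of the two iterated products of three trees. -/
theorem bijective_assoc (t₁ t₂ t₃ : X.Tree) : Function.Bijective
    (fun p : Σ d : X.TreesOf (X.delRoot t₁) → X.Nodes t₂,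
        X.TreesOf (X.delRoot (X.attach t₂ (X.delRoot t₁) d)) → X.Nodes t₃ =>
      (⟨assocFst p.1 p.2, assocSnd p.1 p.2⟩ : Σ f : X.TreesOf (X.delRoot t₂) → X.Nodes t₃,
        X.TreesOf (X.delRoot t₁) → X.Nodes (X.attach t₃ (X.delRoot t₂) f))) := by
  constructor
  · rintro ⟨d, e⟩ ⟨d', e'⟩ h
    have hf : assocFst d e = assocFst d' e' := congrArg Sigma.fst h
    -- `attachNode` maps the second components, of different types, to a common type.
    have hg : ∀ s, attachNode _ (assocSnd d e s) = attachNode _ (assocSnd d' e' s) :=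
      fun s => congrArg (fun q : Σ f : X.TreesOf (X.delRoot t₂) → X.Nodes t₃,
        X.TreesOf (X.delRoot t₁) → X.Nodes (X.attach t₃ (X.delRoot t₂) f) =>
          attachNode q.1 (q.2 s)) h
    obtain rfl := eq_of_attachNode_assocSnd_eq hg
    congr 1
    funext y
    rcases eq_iota_or_rootLinked d y with ⟨s, rfl⟩ | ⟨x, hx, rfl⟩
    · exact congrFun hf s
    · have := hg x
      rw [attachNode_assocSnd_of_eq d e x hx, attachNode_assocSnd_of_eq d e' x hx] at this
      exact Sum.inl_injective this
  · rintro ⟨f, g⟩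
    obtain ⟨d, e, rfl, hg⟩ := exists_assoc_eq f fun s => attachNode _ (g s)
    exact ⟨⟨d, e⟩, Sigma.ext rfl (heq_of_eq (funext fun s => attachNode_injective _ (hg s)))⟩

end Assoc

/-! ### Restriction -/

section Restrict

variable {V : X.Forest} {U : Set (X.TreesOf V)}

/-- A node of the restriction `V|U`, as a node of `V`. -/
def restrictNode (a : (X.underF (X.restrict V U)).Node) : (X.underF V).Node :=
  (X.restrictIso V U a).1

theorem restrictNode_mem (a : (X.underF (X.restrict V U)).Node) :
    restrictNode a ∈ (X.underF V).nodesOver U :=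
  (X.restrictIso V U a).2

theorem restrictNode_injective : Function.Injective
    (restrictNode : (X.underF (X.restrict V U)).Node → (X.underF V).Node) := fun _ _ h =>
  (X.restrictIso V U).injective (Subtype.ext h)

@[simp]
theorem restrictNode_toRestrict (a : (X.underF V).Node) (h : a ∈ (X.underF V).nodesOver U) :
    restrictNode (toRestrict a h) = a :=
  congrArg Subtype.val ((X.restrictIso V U).apply_symm_apply ⟨a, h⟩)

theorem coe_ofRestrict (s : X.TreesOf (X.restrict V U)) :
    (ofRestrict s).1 = restrictNode s.1 := rfl

theorem ofRestrict_injective :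
    Function.Injective (ofRestrict : X.TreesOf (X.restrict V U) → X.TreesOf V) := fun a b h => by
  have h' : restrictNode a.1 = restrictNode b.1 := by
    rw [← coe_ofRestrict, ← coe_ofRestrict, h]
  exact Subtype.ext (restrictNode_injective h')

theorem exists_ofRestrict_eq {x : X.TreesOf V} (hx : x ∈ U) :
    ∃ s : X.TreesOf (X.restrict V U), ofRestrict s = x := by
  have hr : ((X.underF V).subforest U).IsRoot ⟨x.1, FinForest.coe_mem_nodesOver hx⟩ :=
    fun p hp => x.2 p.1 hp
  exact ⟨⟨toRestrict x.1 (FinForest.coe_mem_nodesOver hx),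
    FinForest.isRoot_iso (X.restrictIso V U).symm hr⟩,
    Subtype.ext (restrictNode_toRestrict _ _)⟩

end Restrict

/-! ### Attachment and restriction -/

section HopfCondition

open scoped Classical

variable {t : X.Tree} {Y : X.Forest}

/-- A node of the tree obtained from `t` by keeping only some of the trees of `delRoot t`, as a
node of `t`; the new root becomes the root of `t`. -/
def baseNode {V : Set (X.TreesOf (X.delRoot t))}
    (a : X.Nodes (X.addRoot (X.restrict (X.delRoot t) V))) : X.Nodes t :=
  Sum.elim (fun _ => X.root t) (fun b => delRootNode (restrictNode b)) (attachNode _ a)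

/-- A linking function to such a tree is therefore determined by its composition with `baseNode`. -/
theorem baseNode_injective (hX : X.Axioms) {V : Set (X.TreesOf (X.delRoot t))} :
    Function.Injective (baseNode : X.Nodes (X.addRoot (X.restrict (X.delRoot t) V)) → _) := by
  have : Subsingleton (X.Nodes X.e) :=
    (Nat.card_eq_one_iff_unique.1 ((hX.card_nodes_eq_one_iff X.e).2 rfl)).1
  intro a b h
  refine attachNode_injective _ ?_
  unfold baseNode at h
  generalize attachNode _ a = a at h ⊢
  generalize attachNode _ b = b at h ⊢
  rcases a with a | a <;> rcases b with b | b
  · rw [Subsingleton.elim a b]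
  · exact absurd h.symm (delRootNode_ne_root _)
  · exact absurd h (delRootNode_ne_root _)
  · rw [restrictNode_injective (delRootNode_injective h)]

theorem toDelRoot_baseNode_mem {V : Set (X.TreesOf (X.delRoot t))}
    (a : X.Nodes (X.addRoot (X.restrict (X.delRoot t) V))) (h : baseNode a ≠ X.root t) :
    toDelRoot (baseNode a) h ∈ (X.underF (X.delRoot t)).nodesOver V := by
  revert h
  unfold baseNode
  rcases attachNode _ a with a | a <;> intro h
  · exact absurd rfl h
  · simp only [Sum.elim_inr, toDelRoot_delRootNode]
    exact restrictNode_mem a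

theorem baseNode_partLink (d : X.TreesOf Y → X.Nodes t)
    (U : Set (X.TreesOf (X.delRoot (X.attach t Y d))))
    (w : X.TreesOf (X.restrict Y (attachedPart d U))) :
    baseNode (partLink d U w) = d (ofRestrict w) := by
  unfold partLink baseNode
  split_ifs with h
  · rw [attachNode_ofBase, h]
    rfl
  · rw [attachNode_ofAttached, Sum.elim_inr, restrictNode_toRestrict, delRootNode_toDelRoot]

/-- The compatibility of attachment and restriction, with the parts of a set of trees and the
induced linking function given by their properties. -/
theorem addRoot_restrict_eq (hX : X.Axioms) {d : X.TreesOf Y → X.Nodes t}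
    {U : Set (X.TreesOf (X.delRoot (X.attach t Y d)))}
    {V : Set (X.TreesOf (X.delRoot t))} {W : Set (X.TreesOf Y)}
    (p : X.TreesOf (X.restrict Y W) → X.Nodes (X.addRoot (X.restrict (X.delRoot t) V)))
    (hV : basePart d U = V) (hW : attachedPart d U = W)
    (hp : ∀ w, baseNode (p w) = d (ofRestrict w)) :
    X.addRoot (X.restrict (X.delRoot (X.attach t Y d)) U) =
      X.attach (X.addRoot (X.restrict (X.delRoot t) V)) (X.restrict Y W) p := by
  subst hV hW
  have : p = partLink d U := funext fun w =>
    baseNode_injective hX ((hp w).trans (baseNode_partLink d U w).symm)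
  rw [this, hX.addRoot_restrict]

theorem basePart_compl (d : X.TreesOf Y → X.Nodes t)
    (U : Set (X.TreesOf (X.delRoot (X.attach t Y d)))) :
    basePart d Uᶜ = (basePart d U)ᶜ := rfl

theorem mem_attachedPart_of_eq {d : X.TreesOf Y → X.Nodes t}
    {U : Set (X.TreesOf (X.delRoot (X.attach t Y d)))} {w : X.TreesOf Y} (h : d w = X.root t) :
    w ∈ attachedPart d U ↔ rootLinked d w h ∈ U :=
  ⟨fun hw => hw.elim (fun h' => h'.2) fun h' => absurd h h'.1, fun hw => Or.inl ⟨h, hw⟩⟩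

theorem mem_attachedPart_of_ne {d : X.TreesOf Y → X.Nodes t}
    {U : Set (X.TreesOf (X.delRoot (X.attach t Y d)))} {w : X.TreesOf Y} (h : d w ≠ X.root t) :
    w ∈ attachedPart d U ↔
      toDelRoot (d w) h ∈ (X.underF (X.delRoot t)).nodesOver (basePart d U) :=
  ⟨fun hw => hw.elim (fun h' => absurd h'.1 h) fun h' => h'.2, fun hw => Or.inr ⟨h, hw⟩⟩

theorem attachedPart_compl (d : X.TreesOf Y → X.Nodes t)
    (U : Set (X.TreesOf (X.delRoot (X.attach t Y d)))) :
    attachedPart d Uᶜ = (attachedPart d U)ᶜ := by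
  ext w
  by_cases h : d w = X.root t
  · rw [Set.mem_compl_iff, mem_attachedPart_of_eq h, mem_attachedPart_of_eq h, Set.mem_compl_iff]
  · rw [Set.mem_compl_iff, mem_attachedPart_of_ne h, mem_attachedPart_of_ne h, basePart_compl,
      FinForest.nodesOver_compl, Set.mem_compl_iff]

/-- The set of trees of `delRoot (attach t Y d)` that consists of the trees in `V` and of the trees
in `W` that are linked to the root. -/
def joinParts (d : X.TreesOf Y → X.Nodes t) (V : Set (X.TreesOf (X.delRoot t)))
    (W : Set (X.TreesOf Y)) : Set (X.TreesOf (X.delRoot (X.attach t Y d))) :=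
  {y | (∃ v ∈ V, y = iota d v) ∨ ∃ w ∈ W, ∃ h, y = rootLinked d w h}

theorem rootLinked_mem_joinParts {d : X.TreesOf Y → X.Nodes t}
    {V : Set (X.TreesOf (X.delRoot t))} {W : Set (X.TreesOf Y)} {w : X.TreesOf Y}
    (h : d w = X.root t) : rootLinked d w h ∈ joinParts d V W ↔ w ∈ W := by
  constructor
  · rintro (⟨v, _, hv⟩ | ⟨w', hw', h', e⟩)
    · exact absurd hv.symm (iota_ne_rootLinked d v w h)
    · exact rootLinked_injective d e ▸ hw'
  · exact fun hw => Or.inr ⟨w, hw, h, rfl⟩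

theorem basePart_joinParts (d : X.TreesOf Y → X.Nodes t) (V : Set (X.TreesOf (X.delRoot t)))
    (W : Set (X.TreesOf Y)) : basePart d (joinParts d V W) = V := by
  ext v
  constructor
  · rintro (⟨v', hv', h⟩ | ⟨w, _, hw, h⟩)
    · exact iota_injective d h ▸ hv'
    · exact absurd h (iota_ne_rootLinked d v w hw)
  · exact fun hv => Or.inl ⟨v, hv, rfl⟩

theorem joinParts_basePart_attachedPart (d : X.TreesOf Y → X.Nodes t)
    (U : Set (X.TreesOf (X.delRoot (X.attach t Y d)))) :
    joinParts d (basePart d U) (attachedPart d U) = U := by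
  ext y
  rcases eq_iota_or_rootLinked d y with ⟨s, rfl⟩ | ⟨x, hx, rfl⟩
  · change s ∈ basePart d (joinParts d _ _) ↔ s ∈ basePart d U
    rw [basePart_joinParts]
  · rw [rootLinked_mem_joinParts, mem_attachedPart_of_eq hx]

/-- A pair of subforests, of `delRoot t` and of `Y`, with a linking function for the chosen trees
and one for the other trees: the index of a term in the product of two coproducts. -/
abbrev SplitLink (t : X.Tree) (Y : X.Forest) : Type :=
  Σ q : Set (X.TreesOf Y) × Set (X.TreesOf (X.delRoot t)),
    (X.TreesOf (X.restrict Y q.1) → X.Nodes (X.addRoot (X.restrict (X.delRoot t) q.2))) ×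
    (X.TreesOf (X.restrict Y q.1ᶜ) → X.Nodes (X.addRoot (X.restrict (X.delRoot t) q.2ᶜ)))

/-- The linking function made from one for the trees in a subforest and one for the others. -/
noncomputable def SplitLink.glue (q : SplitLink t Y) : X.TreesOf Y → X.Nodes t := fun w =>
  if h : w ∈ q.1.1 then baseNode (q.2.1 (exists_ofRestrict_eq h).choose)
  else baseNode (q.2.2 (exists_ofRestrict_eq (U := q.1.1ᶜ) h).choose)

theorem SplitLink.glue_left (q : SplitLink t Y) (s : X.TreesOf (X.restrict Y q.1.1)) :
    q.glue (ofRestrict s) = baseNode (q.2.1 s) := by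
  have h := ofRestrict_mem s
  rw [glue, dif_pos h, ofRestrict_injective (exists_ofRestrict_eq h).choose_spec]

theorem SplitLink.glue_right (q : SplitLink t Y) (s : X.TreesOf (X.restrict Y q.1.1ᶜ)) :
    q.glue (ofRestrict s) = baseNode (q.2.2 s) := by
  have h := ofRestrict_mem s
  rw [glue, dif_neg h, ofRestrict_injective (exists_ofRestrict_eq h).choose_spec]

theorem SplitLink.attachedPart_joinParts (q : SplitLink t Y) :
    attachedPart q.glue (joinParts q.glue q.1.2 q.1.1) = q.1.1 := by
  ext w
  by_cases h : q.glue w = X.root t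
  · rw [mem_attachedPart_of_eq h, rootLinked_mem_joinParts]
  · rw [mem_attachedPart_of_ne h, basePart_joinParts]
    by_cases hw : w ∈ q.1.1
    · refine iff_of_true ?_ hw
      obtain ⟨s, rfl⟩ := exists_ofRestrict_eq hw
      simp only [glue_left] at h ⊢
      exact toDelRoot_baseNode_mem _ h
    · refine iff_of_false ?_ hw
      obtain ⟨s, rfl⟩ := exists_ofRestrict_eq (U := q.1.1ᶜ) hw
      simp only [glue_right] at h ⊢
      have := toDelRoot_baseNode_mem _ h
      rwa [FinForest.nodesOver_compl] at this

/-- Linking functions `Y → Nodes t` with a set of trees of `delRoot (attach t Y d)`, the indices of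
the terms in the coproduct of a product, correspond to the indices of the terms in the product of
the coproducts. -/
theorem bijective_glue_joinParts (hX : X.Axioms) (t : X.Tree) (Y : X.Forest) :
    Function.Bijective (fun q : SplitLink t Y =>
      (⟨q.glue, joinParts q.glue q.1.2 q.1.1⟩ :
        Σ d : X.TreesOf Y → X.Nodes t, Set (X.TreesOf (X.delRoot (X.attach t Y d))))) := by
  constructor
  · rintro q q' h
    have hd : q.glue = q'.glue := congrArg Sigma.fst h
    have hV := congrArg (fun s : Σ d : X.TreesOf Y → X.Nodes t,
      Set (X.TreesOf (X.delRoot (X.attach t Y d))) => basePart s.1 s.2) h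
    have hW := congrArg (fun s : Σ d : X.TreesOf Y → X.Nodes t,
      Set (X.TreesOf (X.delRoot (X.attach t Y d))) => attachedPart s.1 s.2) h
    simp only [basePart_joinParts, SplitLink.attachedPart_joinParts] at hV hW
    obtain ⟨⟨W, V⟩, p, p'⟩ := q
    obtain ⟨⟨W', V'⟩, r, r'⟩ := q'
    dsimp only at hV hW
    subst hV hW
    refine Sigma.ext rfl (heq_of_eq (Prod.ext (funext fun s => ?_) (funext fun s => ?_)))
    · refine baseNode_injective hX ?_
      rw [← SplitLink.glue_left ⟨(W, V), p, p'⟩ s, hd, SplitLink.glue_left]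
    · refine baseNode_injective hX ?_
      rw [← SplitLink.glue_right ⟨(W, V), p, p'⟩ s, hd, SplitLink.glue_right]
  · rintro ⟨d, U⟩
    have hex : ∃ r : X.TreesOf (X.restrict Y (attachedPart d U)ᶜ) →
        X.Nodes (X.addRoot (X.restrict (X.delRoot t) (basePart d U)ᶜ)),
        ∀ w, baseNode (r w) = d (ofRestrict w) := by
      rw [← basePart_compl, ← attachedPart_compl]
      exact ⟨partLink d Uᶜ, baseNode_partLink d Uᶜ⟩
    obtain ⟨r, hr⟩ := hex
    let q : SplitLink t Y := ⟨(attachedPart d U, basePart d U), partLink d U, r⟩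
    have hq : q.glue = d := by
      funext w
      by_cases hw : w ∈ attachedPart d U
      · obtain ⟨s, rfl⟩ := exists_ofRestrict_eq hw
        exact (q.glue_left s).trans (baseNode_partLink d U s)
      · obtain ⟨s, rfl⟩ := exists_ofRestrict_eq (U := (attachedPart d U)ᶜ) hw
        exact (q.glue_right s).trans (hr s)
    refine ⟨q, ?_⟩
    dsimp only
    rw [hq]
    exact Sigma.ext rfl (heq_of_eq (joinParts_basePart_attachedPart d U))

end HopfCondition

/-! ### Degrees -/

/-- The degree of a tree: the number of its nodes other than the root. -/
noncomputable def deg (t : X.Tree) : ℕ := Nat.card (X.underF (X.delRoot t)).Node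

theorem card_nodes (t : X.Tree) : Nat.card (X.Nodes t) = deg t + 1 := by
  have h : deg t = ({X.root t}ᶜ : Set (X.Nodes t)).ncard :=
    (Nat.card_congr (X.delRootIso t).toEquiv).trans (Nat.card_coe_set_eq _)
  have := Set.ncard_add_ncard_compl ({X.root t} : Set (X.Nodes t))
  rw [Set.ncard_singleton] at this
  omega

theorem deg_eq_zero_iff (hX : X.Axioms) (t : X.Tree) : deg t = 0 ↔ t = X.e := by
  rw [← hX.card_nodes_eq_one_iff, card_nodes]
  omega

theorem deg_attach (t : X.Tree) (U : X.Forest) (d : X.TreesOf U → X.Nodes t) :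
    deg (X.attach t U d) = deg t + Nat.card (X.underF U).Node := by
  have h : Nat.card (X.Nodes (X.attach t U d)) =
      Nat.card (X.Nodes t) + Nat.card (X.underF U).Node :=
    (Nat.card_congr (X.attachIso t U d).toEquiv).trans Nat.card_sum
  rw [card_nodes, card_nodes] at h
  omega

theorem deg_addRoot (hX : X.Axioms) (V : X.Forest) :
    deg (X.addRoot V) = Nat.card (X.underF V).Node := by
  rw [deg, hX.delRoot_addRoot]

theorem card_restrict (V : X.Forest) (U : Set (X.TreesOf V)) :
    Nat.card (X.underF (X.restrict V U)).Node = ((X.underF V).nodesOver U).ncard :=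
  (Nat.card_congr (X.restrictIso V U).toEquiv).trans (Nat.card_coe_set_eq _)

theorem deg_restrict_add_deg_restrict_compl (hX : X.Axioms) (V : X.Forest)
    (U : Set (X.TreesOf V)) :
    deg (X.addRoot (X.restrict V U)) + deg (X.addRoot (X.restrict V Uᶜ)) =
      Nat.card (X.underF V).Node := by
  rw [deg_addRoot hX, deg_addRoot hX, card_restrict, card_restrict, FinForest.nodesOver_compl,
    Set.ncard_add_ncard_compl]

theorem addRoot_restrict_eq_e_iff (hX : X.Axioms) (V : X.Forest) (U : Set (X.TreesOf V)) :
    X.addRoot (X.restrict V U) = X.e ↔ U = ∅ := by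
  rw [← deg_eq_zero_iff hX, deg_addRoot hX, card_restrict, Set.ncard_eq_zero,
    FinForest.nodesOver_eq_empty_iff]

theorem addRoot_restrict_univ (hX : X.Axioms) (t : X.Tree) :
    X.addRoot (X.restrict (X.delRoot t) Set.univ) = t := by
  rw [hX.restrict_univ, hX.addRoot_delRoot]

theorem delRoot_e (hX : X.Axioms) : X.delRoot X.e = X.empty := by
  refine (hX.isEmpty_iff _).1 ?_
  rw [← Finite.card_eq_zero_iff]
  exact (deg_eq_zero_iff hX X.e).2 rfl

theorem isEmpty_treesOf_empty (hX : X.Axioms) : IsEmpty (X.TreesOf X.empty) := by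
  have := (hX.isEmpty_iff X.empty).2 rfl
  exact Subtype.isEmpty_of_false fun a => isEmptyElim a

/-! ### Sums over linking functions and over subforests -/

section Sums

variable {M : Type*} [AddCommMonoid M]

theorem sum_link_congr {Z Z' : X.Forest} (h : Z = Z') (t : X.Tree) (f : X.Tree → M) :
    ∑ d : X.TreesOf Z → X.Nodes t, f (X.attach t Z d) =
      ∑ d : X.TreesOf Z' → X.Nodes t, f (X.attach t Z' d) := by
  subst h
  rfl

theorem sum_subforest_congr {Z Z' : X.Forest} (h : Z = Z') (f : X.Forest → X.Forest → M) :
    ∑ U : Set (X.TreesOf Z), f (X.restrict Z U) (X.restrict Z Uᶜ) =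
      ∑ U : Set (X.TreesOf Z'), f (X.restrict Z' U) (X.restrict Z' Uᶜ) := by
  subst h
  rfl

open scoped Classical in
/-- The ways to split a restriction `V|U` in two correspond to the subsets of `U`. -/
theorem sum_restrict_restrict (hX : X.Axioms) (V : X.Forest) (U : Set (X.TreesOf V))
    (f : X.Forest → X.Forest → M) :
    ∑ S : Set (X.TreesOf (X.restrict V U)),
        f (X.restrict (X.restrict V U) S) (X.restrict (X.restrict V U) Sᶜ) =
      ∑ A : Set (X.TreesOf V) with A ⊆ U, f (X.restrict V A) (X.restrict V (U \ A)) := by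
  symm
  refine Finset.sum_bij' (fun A _ => ofRestrict ⁻¹' A) (fun S _ => ofRestrict '' S)
    (fun _ _ => Finset.mem_univ _) ?_ ?_ ?_ ?_
  · intro S _
    simp only [Finset.mem_filter, Finset.mem_univ, true_and]
    rintro _ ⟨s, _, rfl⟩
    exact ofRestrict_mem s
  · intro A hA
    simp only [Finset.mem_filter, Finset.mem_univ, true_and] at hA
    refine Set.image_preimage_eq_of_subset fun x hx => ?_
    exact exists_ofRestrict_eq (hA hx)
  · intro S _
    exact Set.preimage_image_eq S ofRestrict_injective
  · intro A hA
    simp only [Finset.mem_filter, Finset.mem_univ, true_and] at hA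
    have hc : (ofRestrict ⁻¹' A : Set (X.TreesOf (X.restrict V U)))ᶜ = {s | ofRestrict s ∈ U \ A} :=
      Set.ext fun s => ⟨fun h => ⟨ofRestrict_mem s, h⟩, fun h => h.2⟩
    rw [hc, hX.restrict_restrict V A U hA, hX.restrict_restrict V (U \ A) U Set.sdiff_subset]
    rfl

open scoped Classical in
/-- Splitting the first part of a forest that was split in two, or splitting the second part, gives
the same triples of subforests. -/
theorem sum_split_left_eq_sum_split_right (hX : X.Axioms) (V : X.Forest)
    (f : X.Forest → X.Forest → X.Forest → M) :
    ∑ U : Set (X.TreesOf V), ∑ S : Set (X.TreesOf (X.restrict V U)),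
        f (X.restrict (X.restrict V U) S) (X.restrict (X.restrict V U) Sᶜ) (X.restrict V Uᶜ) =
      ∑ U : Set (X.TreesOf V), ∑ S : Set (X.TreesOf (X.restrict V Uᶜ)),
        f (X.restrict V U) (X.restrict (X.restrict V Uᶜ) S)
          (X.restrict (X.restrict V Uᶜ) Sᶜ) := by
  have hl := fun U : Set (X.TreesOf V) =>
    sum_restrict_restrict hX V U fun A B => f A B (X.restrict V Uᶜ)
  have hr := fun U : Set (X.TreesOf V) =>
    sum_restrict_restrict hX V Uᶜ fun A B => f (X.restrict V U) A B
  simp only [hl, hr]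
  rw [Finset.sum_sigma', Finset.sum_sigma']
  -- The part `U` split into `A` and `U \ A` corresponds to the part `A` and the subset `U \ A` of
  -- its complement.
  refine Finset.sum_bij' (fun p _ => ⟨p.2, p.1 \ p.2⟩) (fun p _ => ⟨p.1 ∪ p.2, p.1⟩) ?_ ?_ ?_ ?_ ?_
  · rintro ⟨U, A⟩ _
    simp only [Finset.mem_sigma, Finset.mem_univ, Finset.mem_filter, true_and]
    exact fun x hx => hx.2
  · rintro ⟨A, B⟩ _
    simp only [Finset.mem_sigma, Finset.mem_univ, Finset.mem_filter, true_and]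
    exact Set.subset_union_left
  · rintro ⟨U, A⟩ h
    simp only [Finset.mem_sigma, Finset.mem_univ, Finset.mem_filter, true_and] at h
    simp only [Set.union_sdiff_cancel h]
  · rintro ⟨A, B⟩ h
    simp only [Finset.mem_sigma, Finset.mem_univ, Finset.mem_filter, true_and] at h
    have : (A ∪ B) \ A = B := by
      ext x
      have := @h x
      simp only [Set.mem_sdiff, Set.mem_union, Set.mem_compl_iff] at this ⊢
      tauto
    simp only [this]
  · rintro ⟨U, A⟩ h
    simp only [Finset.mem_sigma, Finset.mem_univ, Finset.mem_filter, true_and] at h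
    have : Aᶜ \ (U \ A) = Uᶜ := by
      ext x
      have := @h x
      simp only [Set.mem_sdiff, Set.mem_compl_iff]
      tauto
    simp only [this]

/-- The two iterated products of three trees have the same terms. -/
theorem sum_assoc (hX : X.Axioms) (t₁ t₂ t₃ : X.Tree) (f : X.Tree → M) :
    ∑ d : X.TreesOf (X.delRoot t₁) → X.Nodes t₂,
      ∑ e : X.TreesOf (X.delRoot (X.attach t₂ (X.delRoot t₁) d)) → X.Nodes t₃,
        f (X.attach t₃ (X.delRoot (X.attach t₂ (X.delRoot t₁) d)) e) =
    ∑ d : X.TreesOf (X.delRoot t₂) → X.Nodes t₃,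
      ∑ e : X.TreesOf (X.delRoot t₁) → X.Nodes (X.attach t₃ (X.delRoot t₂) d),
        f (X.attach (X.attach t₃ (X.delRoot t₂) d) (X.delRoot t₁) e) := by
  rw [← Fintype.sum_sigma', ← Fintype.sum_sigma']
  refine Fintype.sum_bijective _ (bijective_assoc t₁ t₂ t₃) _ _ fun p => ?_
  exact congrArg f (hX.attach_attach t₁ t₂ t₃ p.1 p.2)

/-- The coproduct of a product and the product of the coproducts have the same terms. -/
theorem sum_attach_split (hX : X.Axioms) (t : X.Tree) (Y : X.Forest) (f : X.Tree → X.Tree → M) :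
    ∑ d : X.TreesOf Y → X.Nodes t, ∑ U : Set (X.TreesOf (X.delRoot (X.attach t Y d))),
      f (X.addRoot (X.restrict (X.delRoot (X.attach t Y d)) U))
        (X.addRoot (X.restrict (X.delRoot (X.attach t Y d)) Uᶜ)) =
    ∑ W : Set (X.TreesOf Y), ∑ V : Set (X.TreesOf (X.delRoot t)),
      ∑ p : X.TreesOf (X.restrict Y W) → X.Nodes (X.addRoot (X.restrict (X.delRoot t) V)),
        ∑ q : X.TreesOf (X.restrict Y Wᶜ) → X.Nodes (X.addRoot (X.restrict (X.delRoot t) Vᶜ)),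
          f (X.attach (X.addRoot (X.restrict (X.delRoot t) V)) (X.restrict Y W) p)
            (X.attach (X.addRoot (X.restrict (X.delRoot t) Vᶜ)) (X.restrict Y Wᶜ) q) := by
  simp only [← Fintype.sum_prod_type']
  rw [← Fintype.sum_sigma', ← Fintype.sum_sigma']
  symm
  refine Fintype.sum_bijective _ (bijective_glue_joinParts hX t Y) _ _ fun q => ?_
  dsimp only
  rw [addRoot_restrict_eq hX q.2.1 (basePart_joinParts _ _ _) q.attachedPart_joinParts
      fun w => (q.glue_left w).symm,
    addRoot_restrict_eq hX q.2.2 (by rw [basePart_compl, basePart_joinParts])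
      (by rw [attachedPart_compl, q.attachedPart_joinParts]) fun w => (q.glue_right w).symm]

end Sums

/-! ### The bialgebra of trees -/

/-- The free module on the trees of a family. The proof of the axioms is a parameter so that the ring
structure can be an instance. -/
def TreeAlgebra (k : Type w) [CommRing k] (X : TreeFamily.{u, v}) (_ : X.Axioms) :
    Type (max u w) :=
  X.Tree →₀ k

namespace TreeAlgebra

variable (k : Type w) [CommRing k] (hX : X.Axioms)

noncomputable instance : AddCommGroup (TreeAlgebra k X hX) :=
  inferInstanceAs (AddCommGroup (X.Tree →₀ k))

noncomputable instance : Module k (TreeAlgebra k X hX) :=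
  inferInstanceAs (Module k (X.Tree →₀ k))

/-- The basis that consists of the trees. -/
noncomputable def basis : Module.Basis X.Tree k (TreeAlgebra k X hX) :=
  Module.Basis.ofRepr (LinearEquiv.refl k (X.Tree →₀ k))

/-- The product, as a bilinear map. -/
noncomputable def mulLin :
    TreeAlgebra k X hX →ₗ[k] TreeAlgebra k X hX →ₗ[k] TreeAlgebra k X hX :=
  (basis k hX).constr k fun t₁ => (basis k hX).constr k fun t₂ =>
    ∑ d : X.TreesOf (X.delRoot t₁) → X.Nodes t₂, basis k hX (X.attach t₂ (X.delRoot t₁) d)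

theorem mulLin_basis (t₁ t₂ : X.Tree) : mulLin k hX (basis k hX t₁) (basis k hX t₂) =
    ∑ d : X.TreesOf (X.delRoot t₁) → X.Nodes t₂,
      basis k hX (X.attach t₂ (X.delRoot t₁) d) := by
  simp only [mulLin, Module.Basis.constr_basis]

theorem mulLin_assoc (a b c : TreeAlgebra k X hX) :
    mulLin k hX (mulLin k hX a b) c = mulLin k hX a (mulLin k hX b c) := by
  have h : (mulLin k hX).compr₂ (mulLin k hX) =
      (LinearMap.llcomp k _ _ _).compl₁₂ (mulLin k hX) (mulLin k hX) := by
    refine (basis k hX).ext fun t₁ => (basis k hX).ext fun t₂ => (basis k hX).ext fun t₃ => ?_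
    simp only [LinearMap.compr₂_apply, LinearMap.compl₁₂_apply, LinearMap.llcomp_apply,
      mulLin_basis, map_sum, LinearMap.sum_apply]
    exact sum_assoc hX t₁ t₂ t₃ (basis k hX)
  exact LinearMap.congr_fun (LinearMap.congr_fun (LinearMap.congr_fun h a) b) c

theorem mulLin_one_left (a : TreeAlgebra k X hX) : mulLin k hX (basis k hX X.e) a = a := by
  have h : mulLin k hX (basis k hX X.e) = LinearMap.id := by
    refine (basis k hX).ext fun t => ?_
    have := isEmpty_treesOf_empty hX
    rw [mulLin_basis, sum_link_congr (delRoot_e hX) t (basis k hX), Fintype.sum_unique,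
      hX.attach_empty, LinearMap.id_apply]
  exact LinearMap.congr_fun h a

theorem mulLin_one_right (a : TreeAlgebra k X hX) : mulLin k hX a (basis k hX X.e) = a := by
  have h : (mulLin k hX).flip (basis k hX X.e) = LinearMap.id := by
    refine (basis k hX).ext fun t => ?_
    have : Subsingleton (X.Nodes X.e) :=
      (Nat.card_eq_one_iff_unique.1 ((hX.card_nodes_eq_one_iff X.e).2 rfl)).1
    rw [LinearMap.flip_apply, mulLin_basis,
      Fintype.sum_subsingleton _ (fun _ => X.root X.e), LinearMap.id_apply]
    exact congrArg (basis k hX) (hX.addRoot_delRoot t)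
  exact LinearMap.congr_fun h a

noncomputable instance : Ring (TreeAlgebra k X hX) where
  __ := (inferInstance : AddCommGroup (TreeAlgebra k X hX))
  mul a b := mulLin k hX a b
  one := basis k hX X.e
  left_distrib a b c := map_add (mulLin k hX a) b c
  right_distrib a b c := LinearMap.map_add₂ (mulLin k hX) a b c
  zero_mul a := LinearMap.map_zero₂ (mulLin k hX) a
  mul_zero a := map_zero (mulLin k hX a)
  mul_assoc := mulLin_assoc k hX
  one_mul := mulLin_one_left k hX
  mul_one := mulLin_one_right k hX

noncomputable instance : Algebra k (TreeAlgebra k X hX) :=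
  Algebra.ofModule (fun r a b => LinearMap.map_smul₂ (mulLin k hX) r a b)
    fun r a b => map_smul (mulLin k hX a) r b

theorem one_def : (1 : TreeAlgebra k X hX) = basis k hX X.e := rfl

theorem basis_mul_basis (t₁ t₂ : X.Tree) : basis k hX t₁ * basis k hX t₂ =
    ∑ d : X.TreesOf (X.delRoot t₁) → X.Nodes t₂, basis k hX (X.attach t₂ (X.delRoot t₁) d) :=
  mulLin_basis k hX t₁ t₂

theorem basis_addRoot_mul_basis (V : X.Forest) (t : X.Tree) :
    basis k hX (X.addRoot V) * basis k hX t =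
      ∑ d : X.TreesOf V → X.Nodes t, basis k hX (X.attach t V d) := by
  rw [basis_mul_basis, sum_link_congr (hX.delRoot_addRoot V) t (basis k hX)]

open scoped Classical in
noncomputable instance : CoalgebraStruct k (TreeAlgebra k X hX) where
  comul := (basis k hX).constr k fun t => ∑ U : Set (X.TreesOf (X.delRoot t)),
    basis k hX (X.addRoot (X.restrict (X.delRoot t) U)) ⊗ₜ[k]
      basis k hX (X.addRoot (X.restrict (X.delRoot t) Uᶜ))
  counit := (basis k hX).constr k fun t => if t = X.e then 1 else 0

open Coalgebra

theorem comul_basis (t : X.Tree) : comul (R := k) (basis k hX t) =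
    ∑ U : Set (X.TreesOf (X.delRoot t)),
      basis k hX (X.addRoot (X.restrict (X.delRoot t) U)) ⊗ₜ[k]
        basis k hX (X.addRoot (X.restrict (X.delRoot t) Uᶜ)) :=
  (basis k hX).constr_basis k _ t

theorem comul_basis_addRoot (V : X.Forest) : comul (R := k) (basis k hX (X.addRoot V)) =
    ∑ U : Set (X.TreesOf V),
      basis k hX (X.addRoot (X.restrict V U)) ⊗ₜ[k]
        basis k hX (X.addRoot (X.restrict V Uᶜ)) := by
  rw [comul_basis]
  exact sum_subforest_congr (hX.delRoot_addRoot V) fun A B =>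
    basis k hX (X.addRoot A) ⊗ₜ[k] basis k hX (X.addRoot B)

open scoped Classical in
theorem counit_basis (t : X.Tree) :
    counit (R := k) (basis k hX t) = if t = X.e then 1 else 0 :=
  (basis k hX).constr_basis k _ t

noncomputable instance : Coalgebra k (TreeAlgebra k X hX) where
  coassoc := by
    refine (basis k hX).ext fun t => ?_
    simp only [LinearMap.comp_apply, comul_basis k hX t, map_sum, LinearMap.rTensor_tmul,
      LinearMap.lTensor_tmul, comul_basis_addRoot, TensorProduct.sum_tmul, TensorProduct.tmul_sum,
      LinearEquiv.coe_coe, TensorProduct.assoc_tmul]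
    exact sum_split_left_eq_sum_split_right hX (X.delRoot t) fun A B C =>
      basis k hX (X.addRoot A) ⊗ₜ[k] (basis k hX (X.addRoot B) ⊗ₜ[k] basis k hX (X.addRoot C))
  rTensor_counit_comp_comul := by
    classical
    refine (basis k hX).ext fun t => ?_
    simp only [LinearMap.comp_apply, comul_basis k hX t, map_sum, LinearMap.rTensor_tmul,
      counit_basis, addRoot_restrict_eq_e_iff hX]
    rw [Fintype.sum_eq_single ∅ fun U hU => by rw [if_neg hU, TensorProduct.zero_tmul],
      if_pos rfl, Set.compl_empty, addRoot_restrict_univ hX]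
    rfl
  lTensor_counit_comp_comul := by
    classical
    refine (basis k hX).ext fun t => ?_
    simp only [LinearMap.comp_apply, comul_basis k hX t, map_sum, LinearMap.lTensor_tmul,
      counit_basis, addRoot_restrict_eq_e_iff hX, Set.compl_empty_iff]
    rw [Fintype.sum_eq_single Set.univ fun U hU => by rw [if_neg hU, TensorProduct.tmul_zero],
      if_pos rfl, addRoot_restrict_univ hX]
    rfl

instance : IsCocomm k (TreeAlgebra k X hX) where
  comm_comp_comul := by
    refine (basis k hX).ext fun t => ?_
    simp only [LinearMap.comp_apply, comul_basis k hX t, map_sum, LinearEquiv.coe_coe,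
      TensorProduct.comm_tmul]
    refine Fintype.sum_bijective _ compl_involutive.bijective _ _ fun U => ?_
    rw [compl_compl]

theorem comul_one : comul (R := k) (1 : TreeAlgebra k X hX) = 1 := by
  have h : X.restrict X.empty (Set.univ : Set (X.TreesOf X.empty)) = X.empty :=
    hX.restrict_univ _
  have he : X.addRoot X.empty = X.e := hX.attach_empty _ _
  have := isEmpty_treesOf_empty hX
  rw [one_def, ← he, comul_basis_addRoot, Fintype.sum_subsingleton _ Set.univ,
    Subsingleton.elim (Set.univ : Set (X.TreesOf X.empty))ᶜ Set.univ, h, he]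
  rfl

theorem comul_mul (a b : TreeAlgebra k X hX) :
    comul (R := k) (a * b) = comul (R := k) a * comul (R := k) b := by
  have h : (LinearMap.mul k (TreeAlgebra k X hX)).compr₂ comul =
      (LinearMap.mul k (TreeAlgebra k X hX ⊗[k] TreeAlgebra k X hX)).compl₁₂ comul comul := by
    refine (basis k hX).ext fun t₁ => (basis k hX).ext fun t₂ => ?_
    rw [LinearMap.compr₂_apply, LinearMap.compl₁₂_apply, LinearMap.mul_apply',
      LinearMap.mul_apply', basis_mul_basis, map_sum, comul_basis k hX t₁, comul_basis k hX t₂,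
      Finset.sum_mul_sum]
    simp only [comul_basis, Algebra.TensorProduct.tmul_mul_tmul, basis_addRoot_mul_basis,
      TensorProduct.sum_tmul]
    simp only [TensorProduct.tmul_sum]
    exact sum_attach_split hX t₂ (X.delRoot t₁) fun s s' => basis k hX s ⊗ₜ[k] basis k hX s'
  exact LinearMap.congr_fun (LinearMap.congr_fun h a) b

theorem counit_mul (a b : TreeAlgebra k X hX) :
    counit (R := k) (a * b) = counit (R := k) a * counit (R := k) b := by
  classical
  have h : (LinearMap.mul k (TreeAlgebra k X hX)).compr₂ counit =
      (LinearMap.mul k k).compl₁₂ counit counit := by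
    refine (basis k hX).ext fun t₁ => (basis k hX).ext fun t₂ => ?_
    simp only [LinearMap.compr₂_apply, LinearMap.compl₁₂_apply, LinearMap.mul_apply']
    by_cases h₁ : t₁ = X.e
    · rw [h₁, ← one_def, one_mul, one_def, counit_basis k hX X.e, if_pos rfl, one_mul]
    · rw [basis_mul_basis, map_sum, counit_basis k hX t₁, if_neg h₁, zero_mul]
      refine Finset.sum_eq_zero fun d _ => ?_
      rw [counit_basis, if_neg]
      rw [← deg_eq_zero_iff hX] at h₁ ⊢
      have : deg (X.attach t₂ (X.delRoot t₁) d) = deg t₂ + deg t₁ := deg_attach _ _ _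
      omega
  exact LinearMap.congr_fun (LinearMap.congr_fun h a) b

noncomputable instance : Bialgebra k (TreeAlgebra k X hX) :=
  Bialgebra.mk' k (TreeAlgebra k X hX)
    (by classical rw [one_def]; exact (counit_basis k hX _).trans (if_pos rfl))
    (counit_mul k hX _ _) (comul_one k hX) (comul_mul k hX _ _)

/-! ### The grading -/

theorem basis_mem_degreePart (t : X.Tree) : basis k hX t ∈ degreePart (basis k hX) (deg t) :=
  Submodule.subset_span ⟨t, card_nodes t, rfl⟩

variable {k} {hX} in
theorem map_mem_of_mem_degreePart {M : Type*} [AddCommGroup M] [Module k M]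
    (f : TreeAlgebra k X hX →ₗ[k] M) {P : Submodule k M} {n : ℕ}
    (h : ∀ t, deg t = n → f (basis k hX t) ∈ P) {a : TreeAlgebra k X hX}
    (ha : a ∈ degreePart (basis k hX) n) : f a ∈ P := by
  have : degreePart (basis k hX) n ≤ P.comap f := by
    refine Submodule.span_le.2 ?_
    rintro _ ⟨t, ht, rfl⟩
    exact h t (Nat.succ_injective ((card_nodes t).symm.trans ht))
  exact this ha

variable {k} {hX} in
theorem mul_mem_degreePart {m n : ℕ} {a b : TreeAlgebra k X hX}
    (ha : a ∈ degreePart (basis k hX) m) (hb : b ∈ degreePart (basis k hX) n) :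
    a * b ∈ degreePart (basis k hX) (m + n) := by
  refine map_mem_of_mem_degreePart (LinearMap.mulRight k b) (fun t₁ h₁ => ?_) ha
  refine map_mem_of_mem_degreePart (LinearMap.mulLeft k (basis k hX t₁)) (fun t₂ h₂ => ?_) hb
  rw [LinearMap.mulLeft_apply, basis_mul_basis]
  refine Submodule.sum_mem _ fun d _ => ?_
  have h : deg (X.attach t₂ (X.delRoot t₁) d) = deg t₂ + deg t₁ := deg_attach _ _ _
  rw [h₁, h₂, add_comm] at h
  exact h ▸ basis_mem_degreePart k hX _

theorem isInternal_degreePart [Nontrivial k] :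
    DirectSum.IsInternal (degreePart (basis k hX)) := by
  refine DirectSum.isInternal_submodule_of_iSupIndep_of_iSup_eq_top (fun n => ?_) ?_
  · have hle : ⨆ (m) (_ : m ≠ n), degreePart (basis k hX) m ≤
        Submodule.span k (basis k hX '' {t | Nat.card (X.Nodes t) ≠ n + 1}) := by
      refine iSup₂_le fun m hm => Submodule.span_mono (Set.image_mono fun t ht => ?_)
      rw [Set.mem_ofPred_eq] at ht ⊢
      omega
    refine Disjoint.mono_right hle ((basis k hX).linearIndependent.disjoint_span_image ?_)
    exact Set.disjoint_left.2 fun t h h' => h' h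
  · refine top_unique ?_
    rw [← (basis k hX).span_eq, Submodule.span_le]
    rintro _ ⟨t, rfl⟩
    exact Submodule.mem_iSup_of_mem (deg t) (basis_mem_degreePart k hX t)

theorem degreePart_zero : degreePart (basis k hX) 0 = Submodule.span k {1} := by
  have : {t : X.Tree | Nat.card (X.Nodes t) = 0 + 1} = {X.e} :=
    Set.ext fun t => hX.card_nodes_eq_one_iff t
  rw [degreePart, this, Set.image_singleton, one_def]

/-! ### The antipode -/

open WithConv

/-- The difference of the unit of the convolution algebra and the identity. -/
noncomputable def unitSubId : WithConv (TreeAlgebra k X hX →ₗ[k] TreeAlgebra k X hX) :=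
  1 - toConv LinearMap.id

theorem conv_mul_basis (f g : WithConv (TreeAlgebra k X hX →ₗ[k] TreeAlgebra k X hX))
    (t : X.Tree) : (f * g) (basis k hX t) = ∑ U : Set (X.TreesOf (X.delRoot t)),
      f (basis k hX (X.addRoot (X.restrict (X.delRoot t) U))) *
        g (basis k hX (X.addRoot (X.restrict (X.delRoot t) Uᶜ))) := by
  rw [LinearMap.convMul_apply, comul_basis, map_sum, map_sum]
  rfl

theorem conv_mul_basis_congr
    {f f' g g' : WithConv (TreeAlgebra k X hX →ₗ[k] TreeAlgebra k X hX)} {t : X.Tree}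
    (hf : ∀ s, deg s ≤ deg t → f (basis k hX s) = f' (basis k hX s))
    (hg : ∀ s, deg s ≤ deg t → g (basis k hX s) = g' (basis k hX s)) :
    (f * g) (basis k hX t) = (f' * g') (basis k hX t) := by
  rw [conv_mul_basis, conv_mul_basis]
  refine Finset.sum_congr rfl fun U _ => ?_
  have hd : _ + _ = deg t := deg_restrict_add_deg_restrict_compl hX (X.delRoot t) U
  rw [hf _ (by omega), hg _ (by omega)]

theorem unitSubId_basis (t : X.Tree) : unitSubId k hX (basis k hX t) =
    algebraMap k _ (counit (R := k) (basis k hX t)) - basis k hX t := rfl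

theorem unitSubId_basis_e : unitSubId k hX (basis k hX X.e) = 0 := by
  classical
  rw [unitSubId_basis, counit_basis, if_pos rfl, map_one, one_def, sub_self]

theorem unitSubId_basis_of_ne {t : X.Tree} (h : t ≠ X.e) :
    unitSubId k hX (basis k hX t) = -basis k hX t := by
  classical
  rw [unitSubId_basis, counit_basis, if_neg h, map_zero, zero_sub]

theorem unitSubId_basis_mem (t : X.Tree) :
    unitSubId k hX (basis k hX t) ∈ degreePart (basis k hX) (deg t) := by
  by_cases h : t = X.e
  · rw [h, unitSubId_basis_e]
    exact Submodule.zero_mem _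
  · rw [unitSubId_basis_of_ne k hX h]
    exact Submodule.neg_mem _ (basis_mem_degreePart k hX t)

/-- Powers of `1 - id` vanish beyond the degree of a tree: every factor vanishes at the unit, so it uses
up a positive degree. -/
theorem unitSubId_pow_basis_eq_zero {n : ℕ} {t : X.Tree} (h : deg t < n) :
    (unitSubId k hX ^ n) (basis k hX t) = 0 := by
  induction n generalizing t with
  | zero => omega
  | succ n ih =>
    rw [pow_succ', conv_mul_basis]
    refine Finset.sum_eq_zero fun U _ => ?_
    by_cases hU : X.addRoot (X.restrict (X.delRoot t) U) = X.e
    · rw [hU, unitSubId_basis_e, zero_mul]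
    · have hd : _ + _ = deg t := deg_restrict_add_deg_restrict_compl hX (X.delRoot t) U
      rw [← deg_eq_zero_iff hX] at hU
      rw [ih (by omega), mul_zero]

theorem unitSubId_pow_basis_mem (n : ℕ) (t : X.Tree) :
    (unitSubId k hX ^ n) (basis k hX t) ∈ degreePart (basis k hX) (deg t) := by
  classical
  induction n generalizing t with
  | zero =>
    rw [pow_zero, LinearMap.convOne_apply, counit_basis]
    split_ifs with h
    · rw [map_one, h, one_def]
      exact basis_mem_degreePart k hX X.e
    · rw [map_zero]
      exact Submodule.zero_mem _
  | succ n ih =>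
    rw [pow_succ', conv_mul_basis]
    refine Submodule.sum_mem _ fun U _ => ?_
    have hd : _ + _ = deg t := deg_restrict_add_deg_restrict_compl hX (X.delRoot t) U
    exact hd ▸ mul_mem_degreePart (unitSubId_basis_mem k hX _) (ih _)

/-- The antipode `∑ₙ (1 - id)ⁿ`, in the convolution algebra; only the powers up to the degree of a
tree contribute to its value there. -/
noncomputable def antipodeLin : TreeAlgebra k X hX →ₗ[k] TreeAlgebra k X hX :=
  (basis k hX).constr k fun t =>
    ∑ n ∈ Finset.range (deg t + 1), (unitSubId k hX ^ n) (basis k hX t)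

theorem antipodeLin_basis {t : X.Tree} {N : ℕ} (h : deg t ≤ N) :
    antipodeLin k hX (basis k hX t) =
      (∑ n ∈ Finset.range (N + 1), unitSubId k hX ^ n) (basis k hX t) := by
  rw [ofConv_sum, LinearMap.sum_apply, antipodeLin, Module.Basis.constr_basis]
  refine Finset.sum_subset (Finset.range_mono (by omega)) fun n _ hn => ?_
  rw [Finset.mem_range] at hn
  exact unitSubId_pow_basis_eq_zero k hX (by omega)

theorem one_sub_unitSubId : 1 - unitSubId k hX = toConv LinearMap.id := sub_sub_cancel _ _

theorem antipodeLin_mul_id : toConv (antipodeLin k hX) * toConv LinearMap.id = 1 := by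
  refine WithConv.ext ((basis k hX).ext fun t => ?_)
  refine (conv_mul_basis_congr k hX (fun s hs => antipodeLin_basis k hX hs)
    fun _ _ => rfl).trans ?_
  rw [← one_sub_unitSubId, geom_sum_mul_neg, ofConv_sub, LinearMap.sub_apply,
    unitSubId_pow_basis_eq_zero k hX (Nat.lt_succ_self _), sub_zero]

theorem id_mul_antipodeLin : toConv LinearMap.id * toConv (antipodeLin k hX) = 1 := by
  refine WithConv.ext ((basis k hX).ext fun t => ?_)
  refine (conv_mul_basis_congr k hX (fun _ _ => rfl)
    fun s hs => antipodeLin_basis k hX hs).trans ?_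
  rw [← one_sub_unitSubId, mul_neg_geom_sum, ofConv_sub, LinearMap.sub_apply,
    unitSubId_pow_basis_eq_zero k hX (Nat.lt_succ_self _), sub_zero]

noncomputable instance : HopfAlgebra k (TreeAlgebra k X hX) where
  antipode := antipodeLin k hX
  mul_antipode_rTensor_comul := congrArg ofConv (antipodeLin_mul_id k hX)
  mul_antipode_lTensor_comul := congrArg ofConv (id_mul_antipodeLin k hX)

theorem isHopfGrading_degreePart [Nontrivial k] :
    IsHopfGrading k (degreePart (basis k hX)) where
  isInternal := isInternal_degreePart k hX
  one_mem := by
    rw [degreePart_zero]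
    exact Submodule.mem_span_singleton_self 1
  mul_mem _ _ _ _ := mul_mem_degreePart
  counit_eq_zero n a hn ha := by
    classical
    refine (Submodule.mem_bot k).1 (map_mem_of_mem_degreePart _ (fun t ht => ?_) ha)
    rw [Submodule.mem_bot, counit_basis, if_neg]
    rw [← deg_eq_zero_iff hX]
    omega
  comul_mem n a ha := by
    refine map_mem_of_mem_degreePart _ (fun t ht => ?_) ha
    rw [comul_basis]
    refine Submodule.sum_mem _ fun U _ => ?_
    have hd : _ + _ = deg t := deg_restrict_add_deg_restrict_compl hX (X.delRoot t) U
    refine Submodule.mem_iSup_of_mem (_, _) (Submodule.mem_iSup_of_mem (hd.trans ht) ?_)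
    exact ⟨⟨_, basis_mem_degreePart k hX _⟩ ⊗ₜ[k] ⟨_, basis_mem_degreePart k hX _⟩, rfl⟩
  antipode_mem n a ha := by
    refine map_mem_of_mem_degreePart (antipodeLin k hX) (fun t ht => ?_) ha
    rw [antipodeLin, Module.Basis.constr_basis, ← ht]
    exact Submodule.sum_mem _ fun n _ => unitSubId_pow_basis_mem k hX n t

end TreeAlgebra

end TreeFamily

theorem mainTheorem1 {k : Type w} [Field k] [CharZero k] (X : TreeFamily.{u, v}) (hX : X.Axioms) :
    ∃ (H : Type (max u w)) (_ : Ring H) (_ : HopfAlgebra k H) (b : Module.Basis X.Tree k H),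
      (1 : H) = b X.e ∧
      (∀ t₁ t₂ : X.Tree, b t₁ * b t₂ =
        ∑ d : X.TreesOf (X.delRoot t₁) → X.Nodes t₂, b (X.attach t₂ (X.delRoot t₁) d)) ∧
      (∀ t : X.Tree, Coalgebra.comul (R := k) (b t) =
        ∑ U : Set (X.TreesOf (X.delRoot t)),
          b (X.addRoot (X.restrict (X.delRoot t) U)) ⊗ₜ[k]
            b (X.addRoot (X.restrict (X.delRoot t) Uᶜ))) ∧
      Coalgebra.counit (R := k) (b X.e) = 1 ∧
      (∀ t : X.Tree, t ≠ X.e → Coalgebra.counit (R := k) (b t) = 0) ∧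
      Coalgebra.IsCocomm k H ∧
      IsHopfGrading k (TreeFamily.degreePart b) ∧
      IsConnectedGrading k (TreeFamily.degreePart b) := by
  classical
  refine ⟨TreeFamily.TreeAlgebra k X hX, inferInstance, inferInstance,
    TreeFamily.TreeAlgebra.basis k hX, rfl, TreeFamily.TreeAlgebra.basis_mul_basis k hX,
    TreeFamily.TreeAlgebra.comul_basis k hX,
    (TreeFamily.TreeAlgebra.counit_basis k hX X.e).trans (if_pos rfl),
    fun t ht => (TreeFamily.TreeAlgebra.counit_basis k hX t).trans (if_neg ht), inferInstance,
    TreeFamily.TreeAlgebra.isHopfGrading_degreePart k hX, ?_,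
    TreeFamily.TreeAlgebra.degreePart_zero k hX⟩
  rw [TreeFamily.TreeAlgebra.degreePart_zero]
  exact finrank_span_singleton ((TreeFamily.TreeAlgebra.basis k hX).ne_zero X.e)
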